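/- Let $F$ be a countably infinite field, with multiplicative group $F^\times = F\setminus\{0\}$, and let $T$ be a measure-preserving action of the additive group $(F,+)$ on a probability space $(X,\mathscr{B},\mu)$. Then for every polynomial $\phi\in F[x]$ with zero constant term, every $B\in\mathscr{B}$ and every $\epsilon>0$, the set $$\{u\in F : \mu(B\cap T^{\phi(u)}B) > \mu(B)^2-\epsilon\}$$ is almost $\mathrm{MC}^*$, i.e. it is of the form $A\setminus E$ where $A\subset F$ is $\mathrm{MC}^*$ and $E\subset F$ has zero upper Banach density in $(F,+)$. Here the terms are defined as follows. - On the set $\beta F^\times$ of all ultrafilters on $F^\times$ consider the semigroup operation $p * q = \{A\subset F^\times : \{u\in F^\times : Au^{-1}\in p\}\in q\}$, where $Au^{-1}=\{v\in F^\times : vu\in A\}$. A right ideal is a non-empty set $S\subset\beta F^\times$ with $p*q\in S$ for all $p\in S$, $q\in\beta F^\times$; it is minimal if it contains no strictly smaller right ideal. - A set $C\subset F$ is multiplicatively central if $C\cap F^\times$ belongs to some ultrafilter $p\in\beta F^\times$ that satisfies $p*p=p$ and lies in a minimal right ideal of $\beta F^\times$. A set $A\subset F$ is $\mathrm{MC}^*$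 if $A\cap C\neq\emptyset$ for every multiplicatively central $C\subset F$. - A Følner sequence in $(F,+)$ is a sequence $(\Phi_N)$ of finite non-empty subsets of $F$ with $|(g+\Phi_N)\cap\Phi_N|/|\Phi_N|\to 1$ for every $g\in F$. The upper Banach density of $E\subset F$ is the supremum of $\limsup_{N\to\infty}|E\cap\Phi_N|/|\Phi_N|$ over all Følner sequences $(\Phi_N)$ in $(F,+)$. -/

import Mathlib

open Filter Topology MeasureTheory
open scoped ENNReal Pointwise

namespace PolyRec

/-- A Følner sequence in an additive abelian group `G`: finite non-empty sets `Φ N` with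
`|(g + Φ N) ∩ Φ N| / |Φ N| → 1` for every `g`. -/
def IsFolnerSeq {G : Type*} [AddCommGroup G] (Φ : ℕ → Finset G) : Prop :=
  (∀ N, (Φ N).Nonempty) ∧
    ∀ g : G, Tendsto
      (fun N => ((((g + ·) '' (Φ N : Set G)) ∩ (Φ N : Set G)).ncard : ℝ) / ((Φ N).card : ℝ))
      atTop (𝓝 1)

/-- The upper density of `S` along a sequence `Φ` of finite sets. -/
noncomputable def upperDensityAlong {G : Type*} (Φ : ℕ → Finset G) (S : Set G) : ℝ≥0∞ :=
  limsup (fun N => ((S ∩ (Φ N : Set G)).ncard : ℝ≥0∞) / ((Φ N).card : ℝ≥0∞)) atTop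

/-- The upper Banach density of a subset of an additive abelian group: the supremum of its upper
densities along all Følner sequences. -/
noncomputable def upperBanachDensity {G : Type*} [AddCommGroup G] (S : Set G) : ℝ≥0∞ :=
  ⨆ (Φ : ℕ → Finset G) (_ : IsFolnerSeq Φ), upperDensityAlong Φ S

/-- The extension of the multiplication of `M` to ultrafilters:
`p ⋆ q = {A | {u | A u⁻¹ ∈ p} ∈ q}`, where `A u⁻¹ = {v | v * u ∈ A}`. -/
def conv {M : Type*} [Mul M] (p q : Ultrafilter M) : Ultrafilter M :=
  q.bind fun u => p.map (· * u)

theorem mem_conv {M : Type*} [Mul M] (p q : Ultrafilter M) (A : Set M) :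
    A ∈ conv p q ↔ {u : M | {v : M | v * u ∈ A} ∈ p} ∈ q :=
  Iff.rfl

/-- Right ideals of the semigroup of ultrafilters on `M` (non-empty by convention). -/
def IsRightIdeal {M : Type*} [Mul M] (S : Set (Ultrafilter M)) : Prop :=
  S.Nonempty ∧ ∀ p ∈ S, ∀ q : Ultrafilter M, conv p q ∈ S

/-- Minimal right ideals: right ideals that contain no strictly smaller right ideal. -/
def IsMinimalRightIdeal {M : Type*} [Mul M] (S : Set (Ultrafilter M)) : Prop :=
  Minimal IsRightIdeal S

/-- A subset of a commutative semigroup is central if it belongs to an idempotent ultrafilter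
that lies in a minimal right ideal. -/
def IsCentral {M : Type*} [CommSemigroup M] (A : Set M) : Prop :=
  ∃ p : Ultrafilter M, conv p p = p ∧ (∃ S, IsMinimalRightIdeal S ∧ p ∈ S) ∧ A ∈ p

/-- A subset of a field `F` is multiplicatively central if its non-zero elements form a central
set in the multiplicative group of `F`. The element `0` is left out of the semigroup: were it
included, the principal ultrafilter at `0` alone would be the unique minimal right ideal. -/
def IsMC {F : Type*} [Field F] (A : Set F) : Prop :=
  IsCentral {u : Fˣ | (u : F) ∈ A}

/-- `MC*`: the set meets every multiplicatively central set. -/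
def IsMCStar {F : Type*} [Field F] (A : Set F) : Prop :=
  ∀ C : Set F, IsMC C → (A ∩ C).Nonempty

/-- Almost `MC*`: an `MC*` set from which a set of zero upper Banach density in `(F, +)` has been
removed. -/
def IsAMCStar {F : Type*} [Field F] (S : Set F) : Prop :=
  ∃ A E : Set F, IsMCStar A ∧ upperBanachDensity E = 0 ∧ S = A \ E

end PolyRec

/-!
Polynomial recurrence with large intersections, for measure-preserving actions of the additive group
of a countable field `F`.

With `f = 1_B - μ(B)` in `L²(μ)` and the Koopman operators `U g`, the difference
`μ(B ∩ T^g B) - μ(B)²` is the matrix coefficient `⟪f, U g f⟫`. By Gelfand duality and the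
Riesz–Markov–Kakutani theorem (`exists_spectral_measure`) it is a mixture `∫ χ(g) dν(χ)` of characters
of `(F, +)`. It remains to see that `∫ χ(φ(u)) dν(χ) > -ε` for `u` in an almost `MC*` set. The
functions `u ↦ χ(φ(u))` are polynomial phases: products of functions `u ↦ ψ(u ^ k)` with `k ≥ 1` and
`ψ` a character. Two facts about them carry the proof.

* Recurrence (`ulim_phase_of_minimal`): a polynomial phase `κ` tends to `1` along every ultrafilter
  `p` in a minimal right ideal of `(βF^×, ⋆)`. Indeed `p = p ⋆ (q ⋆ r)` for any `q` and a suitable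
  `r`; take `q` idempotent for addition. The inner limit `w ↦ lim_{v → p} κ(v w)` is again a polynomial
  phase, since pointwise limits of characters are characters, and polynomial phases tend to `1`
  along `q` by induction on the degree.

* Equidistribution (`phase_eq_one_or_hasMeanZero`): a non-trivial polynomial phase has mean zero
  along every Følner sequence. This is an induction on the degree by van der Corput's trick, which
  works if the group `H` of those `h` with `κ(v + h) = κ(v) κ(h)` for all `v` has infinite index. If
  `H` has finite index, then `κ` is a character (`isChar_of_finiteIndex`); in characteristic `p`, where
  powers of `p` in exponents hide additive maps, this uses that additive combinations of the vectors
  `(z ^ n)_n` separate exponents that are not related by the Frobenius map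
  (`exists_additive_combination`).

Group the characters `χ` by the phase `χ ∘ φ`. Where the resulting measure has no atoms, the mean of the
squared modulus of the integral is the measure of the diagonal, namely zero, so this part of the
integral is small off a set of zero upper Banach density. Of the atoms, finitely many carry all but
a small part of the mass, and the set of `u` where these finitely many phases have positive real part
is `MC*` by recurrence (`exists_isMCStar_integral_re_gt`).
-/

namespace PolyRec

/-! ### Polynomial phases -/

section Phase

variable {F : Type*} [Field F]

/-- The group of normalised polynomial phases of degree at most `d` on a field: the functions
`F → 𝕋` generated by `u ↦ ψ (u ^ k)`, where `ψ` is a character of `(F, +)` and `1 ≤ k ≤ d`. They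
all take the value `1` at `0`. -/
noncomputable def phase (F : Type*) [Field F] (d : ℕ) : Subgroup (F → Circle) :=
  Subgroup.closure {κ | ∃ (ψ : AddChar F Circle) (k : ℕ), 1 ≤ k ∧ k ≤ d ∧ κ = fun u => ψ (u ^ k)}

theorem char_pow_mem_phase (ψ : AddChar F Circle) {k d : ℕ} (hk : 1 ≤ k) (hd : k ≤ d) :
    (fun u => ψ (u ^ k)) ∈ phase F d :=
  Subgroup.subset_closure ⟨ψ, k, hk, hd, rfl⟩

theorem phase_zero : phase F 0 = ⊥ := by
  rw [phase, Subgroup.closure_eq_bot_iff]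
  rintro κ ⟨ψ, k, h1, h2, rfl⟩
  omega

theorem phase_apply_zero {d : ℕ} {κ : F → Circle} (hκ : κ ∈ phase F d) : κ 0 = 1 := by
  induction hκ using Subgroup.closure_induction with
  | mem κ h =>
    obtain ⟨ψ, k, h1, -, rfl⟩ := h
    simp [zero_pow (by omega : k ≠ 0)]
  | one => rfl
  | mul a b _ _ ha hb => simp [ha, hb]
  | inv a _ ha => simp [ha]

/-- The character `x ↦ ψ (c * x)`. -/
noncomputable def mulChar (ψ : AddChar F Circle) (c : F) : AddChar F Circle :=
  ψ.compAddMonoidHom (AddMonoidHom.mulLeft c)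

@[simp] theorem mulChar_apply (ψ : AddChar F Circle) (c x : F) : mulChar ψ c x = ψ (c * x) := rfl

theorem char_sum {ι : Type*} (ψ : AddChar F Circle) (s : Finset ι) (f : ι → F) :
    ψ (∑ i ∈ s, f i) = ∏ i ∈ s, ψ (f i) := by
  classical
  induction s using Finset.induction_on with
  | empty => simp
  | insert a s ha ih => rw [Finset.sum_insert ha, Finset.prod_insert ha, AddChar.map_add_eq_mul, ih]

/-- A polynomial phase composed with a dilation is again a polynomial phase. -/
theorem phase_dilate {d : ℕ} {κ : F → Circle} (hκ : κ ∈ phase F d) (c : F) :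
    (fun u => κ (u * c)) ∈ phase F d := by
  induction hκ using Subgroup.closure_induction with
  | mem κ h =>
    obtain ⟨ψ, k, h1, h2, rfl⟩ := h
    convert char_pow_mem_phase (mulChar ψ (c ^ k)) h1 h2 using 2 with u
    simp [mul_pow, mul_comm]
  | one => exact one_mem _
  | mul a b _ _ ha hb => exact mul_mem ha hb
  | inv a _ ha => exact inv_mem ha

/-- A character evaluated along a polynomial without constant term is a polynomial phase. -/
theorem char_eval_mem_phase (ψ : AddChar F Circle) (φ : Polynomial F) (hφ : φ.coeff 0 = 0) :
    (fun u => ψ (φ.eval u)) ∈ phase F φ.natDegree := by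
  have : (fun u => ψ (φ.eval u)) =
      ∏ k ∈ Finset.range (φ.natDegree + 1), fun u => mulChar ψ (φ.coeff k) (u ^ k) := by
    funext u
    simp [Polynomial.eval_eq_sum_range, char_sum]
  rw [this]
  refine prod_mem fun k hk => ?_
  rcases Nat.eq_zero_or_pos k with rfl | h0
  · convert one_mem (phase F φ.natDegree) using 1
    funext u
    simp [hφ]
  · exact char_pow_mem_phase _ h0 (by simpa [Nat.lt_succ_iff] using hk)

/-- The multiplicative cross-difference `v ↦ κ (v + h) / (κ v * κ h)`, as an endomorphism of the
group of functions `F → 𝕋`. It is trivial for all `h` exactly when `κ` is a character. -/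
noncomputable def cross (h : F) : (F → Circle) →* (F → Circle) where
  toFun κ v := κ (v + h) / (κ v * κ h)
  map_one' := by funext v; simp
  map_mul' a b := by funext v; simp only [Pi.mul_apply]; rw [mul_mul_mul_comm, mul_div_mul_comm]

theorem cross_apply (h : F) (κ : F → Circle) (v : F) :
    cross h κ v = κ (v + h) / (κ v * κ h) := rfl

theorem apply_add_eq (h : F) (κ : F → Circle) (v : F) :
    κ (v + h) = κ v * κ h * cross h κ v := by
  rw [cross_apply, mul_div_cancel]

theorem add_pow_sub (v h : F) {k : ℕ} (hk : 1 ≤ k) :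
    (v + h) ^ k = v ^ k + h ^ k +
      ∑ j ∈ Finset.Ico 1 k, ((k.choose j : F) * h ^ (k - j)) * v ^ j := by
  rw [add_pow, Finset.sum_range_succ, ← Finset.sum_erase_add _ _ (Finset.mem_range.2 hk)]
  have : (Finset.range k).erase 0 = Finset.Ico 1 k := by
    ext j; simp; omega
  rw [this]
  simp only [tsub_self, pow_zero, mul_one, Nat.choose_self, Nat.cast_one, one_mul, tsub_zero,
    Nat.choose_zero_right]
  rw [Finset.sum_congr rfl fun j _ => show v ^ j * h ^ (k - j) * (k.choose j : F) =
    (k.choose j : F) * h ^ (k - j) * v ^ j by ring]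
  ring

theorem cross_char_pow (ψ : AddChar F Circle) {k : ℕ} (hk : 1 ≤ k) (h v : F) :
    cross h (fun u => ψ (u ^ k)) v =
      ∏ j ∈ Finset.Ico 1 k, ψ (((k.choose j : F) * h ^ (k - j)) * v ^ j) := by
  rw [cross_apply, add_pow_sub v h hk, AddChar.map_add_eq_mul, AddChar.map_add_eq_mul, char_sum,
    mul_div_cancel_left]

/-- Cross-differences lower the degree of a polynomial phase. -/
theorem cross_mem_phase {d : ℕ} {κ : F → Circle} (hκ : κ ∈ phase F (d + 1)) (h : F) :
    cross h κ ∈ phase F d := by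
  have : phase F (d + 1) ≤ (phase F d).comap (cross h) := by
    rw [phase, Subgroup.closure_le]
    rintro κ ⟨ψ, k, h1, h2, rfl⟩
    have : cross h (fun u => ψ (u ^ k)) =
        ∏ j ∈ Finset.Ico 1 k, fun v => mulChar ψ ((k.choose j : F) * h ^ (k - j)) (v ^ j) := by
      funext v
      rw [cross_char_pow ψ h1, Finset.prod_apply]
      rfl
    simp only [Subgroup.coe_comap, Set.mem_preimage, SetLike.mem_coe, this]
    refine prod_mem fun j hj => ?_
    rw [Finset.mem_Ico] at hj
    exact char_pow_mem_phase _ hj.1 (by omega)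
  exact this hκ

end Phase

/-! ### Limits of polynomial phases along ultrafilters -/

section Recurrence

/-- The limit of a function into a compact group along an ultrafilter. -/
noncomputable def ulim {α : Type*} (p : Ultrafilter α) (f : α → Circle) : Circle :=
  (p.map f).lim

theorem tendsto_ulim {α : Type*} (p : Ultrafilter α) (f : α → Circle) :
    Tendsto f p (𝓝 (ulim p f)) := (p.map f).le_nhds_lim

theorem ulim_eq {α : Type*} {p : Ultrafilter α} {f : α → Circle} {z : Circle}
    (h : Tendsto f p (𝓝 z)) : ulim p f = z := tendsto_nhds_unique (tendsto_ulim p f) h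

theorem ulim_mul {α : Type*} (p : Ultrafilter α) (f g : α → Circle) :
    ulim p (fun x => f x * g x) = ulim p f * ulim p g :=
  ulim_eq ((tendsto_ulim p f).mul (tendsto_ulim p g))

theorem ulim_inv {α : Type*} (p : Ultrafilter α) (f : α → Circle) :
    ulim p (fun x => (f x)⁻¹) = (ulim p f)⁻¹ :=
  ulim_eq (tendsto_ulim p f).inv

theorem ulim_const {α : Type*} (p : Ultrafilter α) (z : Circle) :
    ulim p (fun _ => z) = z := ulim_eq tendsto_const_nhds

/-- An iterated limit along a pair of ultrafilters is a limit along any ultrafilter whose members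
are described by the corresponding iterated quantifier. -/
theorem ulim_iterate {α β γ : Type*} {p : Ultrafilter α} {q : Ultrafilter β} {r : Ultrafilter γ}
    (m : α → β → γ) (hr : ∀ A : Set γ, A ∈ r → ∀ᶠ a in p, ∀ᶠ b in q, m a b ∈ A)
    (f : γ → Circle) : ulim r f = ulim p fun a => ulim q fun b => f (m a b) := by
  symm
  refine ulim_eq ?_
  refine (closed_nhds_basis (ulim r f)).tendsto_right_iff.2 ?_
  rintro V ⟨hV, hVc⟩
  filter_upwards [hr _ (tendsto_ulim r f hV)] with a ha
  exact hVc.mem_of_tendsto (tendsto_ulim q _) ha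

variable {F : Type*} [Field F]

attribute [local instance] Ultrafilter.add Ultrafilter.addSemigroup

/-- Polynomial phases converge to `1` along idempotents of `(βF, +)`: if `L` is the limit, then
expanding `κ (u + v)` and using the statement in lower degree gives `L = L * L`. -/
theorem ulim_phase_of_add_idem {q : Ultrafilter F} (hq : q + q = q) (d : ℕ) :
    ∀ κ ∈ phase F d, ulim q κ = 1 := by
  induction d with
  | zero =>
    intro κ hκ
    rw [phase_zero, Subgroup.mem_bot] at hκ
    rw [hκ]
    exact ulim_const q 1
  | succ d ih =>
    intro κ hκ
    have h1 : ulim q κ = ulim q fun a => ulim q fun b => κ (a + b) := by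
      refine ulim_iterate (fun a b => a + b) (fun A hA => ?_) κ
      rw [← hq] at hA
      exact (Ultrafilter.eventually_add q q (· ∈ A)).1 hA
    have h2 : ∀ a, (ulim q fun b => κ (a + b)) = ulim q κ * κ a := by
      intro a
      have : (fun b => κ (a + b)) = fun b => κ b * κ a * cross a κ b := by
        funext b
        rw [add_comm, apply_add_eq a κ b]
      rw [this, ulim_mul, ulim_mul, ulim_const, ih _ (cross_mem_phase hκ a), mul_one]
    simp only [h2] at h1
    rw [ulim_mul, ulim_const] at h1
    exact left_eq_mul.1 h1

/-- The multiplicative group of an infinite field carries an ultrafilter whose image in the field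
is an idempotent for addition. -/
theorem exists_units_add_idem [Infinite F] :
    ∃ q : Ultrafilter Fˣ, q.map ((↑) : Fˣ → F) + q.map (↑) = q.map (↑) := by
  have hc : IsClosed {U : Ultrafilter F | ∀ x, {x}ᶜ ∈ U} := by
    rw [Set.ofPred_forall]
    exact isClosed_iInter fun x => ultrafilter_isClosed_basic _
  obtain ⟨U, hU, hUU⟩ := exists_idempotent_in_compact_add_subsemigroup
    (M := Ultrafilter F) Ultrafilter.continuous_add_left {U | ∀ x, {x}ᶜ ∈ U}
    ⟨hyperfilter F, fun x => Filter.mem_hyperfilter_of_finite_compl (by simp)⟩ hc.isCompact (by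
      intro U _ V hV x
      refine (Ultrafilter.eventually_add U V (· ∈ ({x}ᶜ : Set F))).2 (Eventually.of_forall fun a => ?_)
      filter_upwards [hV (x - a)] with b hb h
      exact hb (eq_sub_of_add_eq' h))
  have hr : Set.range ((↑) : Fˣ → F) ∈ U := by
    filter_upwards [hU 0] with x hx
    exact ⟨Units.mk0 x hx, rfl⟩
  refine ⟨U.comap Units.val_injective hr, ?_⟩
  have : (U.comap Units.val_injective hr).map ((↑) : Fˣ → F) = U :=
    Ultrafilter.coe_injective (by
      rw [Ultrafilter.coe_map, Ultrafilter.coe_comap, Filter.map_comap_of_mem hr])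
  rw [this, hUU]

theorem conv_assoc {M : Type*} [Semigroup M] (p q r : Ultrafilter M) :
    conv (conv p q) r = conv p (conv q r) := by
  ext A
  simp only [mem_conv, Set.mem_ofPred_eq, mul_assoc]

/-- The products `p ⋆ (q ⋆ r)` with `r` arbitrary form a right ideal inside the minimal one that
contains `p`, so `p` itself is such a product. -/
theorem exists_conv_conv_eq {M : Type*} [CommSemigroup M] {S : Set (Ultrafilter M)}
    (hS : IsMinimalRightIdeal S) {p : Ultrafilter M} (hp : p ∈ S) (q : Ultrafilter M) :
    ∃ r, conv p (conv q r) = p := by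
  have hT : IsRightIdeal {x | ∃ r, conv p (conv q r) = x} := by
    refine ⟨⟨_, p, rfl⟩, ?_⟩
    rintro _ ⟨r, rfl⟩ s
    exact ⟨conv r s, by simp only [conv_assoc]⟩
  have hTS : {x | ∃ r, conv p (conv q r) = x} ⊆ S := by
    rintro _ ⟨r, rfl⟩
    exact hS.1.2 p hp _
  exact hS.2 hT hTS hp

theorem ulim_conv {M : Type*} [Mul M] (p q : Ultrafilter M) (f : M → Circle) :
    ulim (conv p q) f = ulim q fun u => ulim p fun v => f (v * u) :=
  ulim_iterate (fun u v => v * u) (fun _ hA => hA) f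

/-- Averaging a polynomial phase over dilations, in the sense of a limit along an ultrafilter,
gives a polynomial phase: a pointwise limit of characters is a character. -/
theorem ulim_dilate_mem_phase (p : Ultrafilter Fˣ) {d : ℕ} {κ : F → Circle} (hκ : κ ∈ phase F d) :
    (fun w => ulim p fun v : Fˣ => κ (v * w)) ∈ phase F d := by
  induction hκ using Subgroup.closure_induction with
  | mem κ h =>
    obtain ⟨ψ, k, h1, h2, rfl⟩ := h
    let ψ' : AddChar F Circle :=
      { toFun x := ulim p fun v : Fˣ => ψ ((v : F) ^ k * x)
        map_zero_eq_one' := by simp [ulim_const]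
        map_add_eq_mul' x y := by simp only [mul_add, AddChar.map_add_eq_mul, ulim_mul] }
    convert char_pow_mem_phase ψ' h1 h2 using 2 with w
    simp only [mul_pow]
    rfl
  | one =>
    simp only [Pi.one_apply, ulim_const]
    exact one_mem _
  | mul a b _ _ ha hb =>
    simp only [Pi.mul_apply, ulim_mul]
    exact mul_mem ha hb
  | inv a _ ha =>
    simp only [Pi.inv_apply, ulim_inv]
    exact inv_mem ha

/-- Polynomial phases converge to `1` along every ultrafilter in a minimal right ideal of
`(βF^×, ⋆)`. -/
theorem ulim_phase_of_minimal [Infinite F] {S : Set (Ultrafilter Fˣ)} (hS : IsMinimalRightIdeal S)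
    {p : Ultrafilter Fˣ} (hp : p ∈ S) {d : ℕ} {κ : F → Circle} (hκ : κ ∈ phase F d) :
    ulim p (fun u : Fˣ => κ u) = 1 := by
  obtain ⟨q, hq⟩ := exists_units_add_idem (F := F)
  obtain ⟨r, hr⟩ := exists_conv_conv_eq hS hp q
  set G : F → Circle := fun w => ulim p fun v : Fˣ => κ (v * w) with hG
  have hGm : G ∈ phase F d := ulim_dilate_mem_phase p hκ
  have h : ∀ f : F → Circle, f ∈ phase F d → ulim q (fun v : Fˣ => f v) = 1 := by
    intro f hf
    rw [← ulim_phase_of_add_idem hq d f hf]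
    rfl
  calc ulim p (fun u : Fˣ => κ u) = ulim (conv p (conv q r)) (fun u : Fˣ => κ u) := by rw [hr]
    _ = ulim r fun u => ulim q fun v : Fˣ => G (v * u) := by
        rw [ulim_conv, ulim_conv]
        simp only [Units.val_mul, hG]
    _ = ulim r fun _ => 1 := by
        congr 1
        funext u
        exact h _ (phase_dilate hGm u)
    _ = 1 := ulim_const r 1

end Recurrence

/-! ### Averages along Følner sequences -/

section Mean

/-- The average of `f` over a finite set. -/
noncomputable def avg {F : Type*} (s : Finset F) (f : F → ℂ) : ℂ := (∑ u ∈ s, f u) / (s.card : ℂ)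

/-- The averages of `f` along every Følner sequence tend to `0`. -/
def HasMeanZero {F : Type*} [AddCommGroup F] (f : F → ℂ) : Prop :=
  ∀ Φ : ℕ → Finset F, IsFolnerSeq Φ → Tendsto (fun N => avg (Φ N) f) atTop (𝓝 0)

theorem avg_const_mul {F : Type*} (s : Finset F) (c : ℂ) (f : F → ℂ) :
    avg s (fun u => c * f u) = c * avg s f := by
  rw [avg, avg, ← Finset.mul_sum, mul_div_assoc]

theorem avg_sum {F ι : Type*} (s : Finset F) (t : Finset ι) (f : ι → F → ℂ) :
    avg s (fun u => ∑ i ∈ t, f i u) = ∑ i ∈ t, avg s (f i) := by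
  simp only [avg]
  rw [Finset.sum_comm, Finset.sum_div]

theorem norm_avg_le {F : Type*} (s : Finset F) {f : F → ℂ} (hf : ∀ u, ‖f u‖ ≤ 1) :
    ‖avg s f‖ ≤ 1 := by
  rw [avg, norm_div, Complex.norm_natCast]
  refine div_le_one_of_le₀ ?_ (by positivity)
  exact (norm_sum_le _ _).trans ((Finset.sum_le_sum fun u _ => hf u).trans (by simp))

theorem norm_sq_avg_le {F : Type*} (s : Finset F) (g : F → ℂ) :
    ‖avg s g‖ ^ 2 ≤ (∑ u ∈ s, ‖g u‖ ^ 2) / s.card := by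
  rw [avg, norm_div, Complex.norm_natCast, div_pow]
  rcases Nat.eq_zero_or_pos s.card with h | h
  · simp [h]
  have h' : (0 : ℝ) < s.card := by exact_mod_cast h
  rw [div_le_div_iff₀ (by positivity) h']
  have h1 : ‖∑ u ∈ s, g u‖ ^ 2 ≤ (∑ u ∈ s, ‖g u‖) ^ 2 := by gcongr; exact norm_sum_le _ _
  have h2 := sq_sum_le_card_mul_sum_sq (s := s) (f := fun u => ‖g u‖)
  nlinarith

variable {F : Type*} [AddCommGroup F]

theorem tendsto_avg_shift_sub {Φ : ℕ → Finset F} (hΦ : IsFolnerSeq Φ) {f : F → ℂ}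
    (hf : ∀ u, ‖f u‖ ≤ 1) (h : F) :
    Tendsto (fun N => avg (Φ N) (fun u => f (u + h)) - avg (Φ N) f) atTop (𝓝 0) := by
  classical
  have hlim : Tendsto (fun N => 2 * (1 - ((((h + ·) '' (Φ N : Set F)) ∩ (Φ N : Set F)).ncard : ℝ) /
      ((Φ N).card : ℝ))) atTop (𝓝 0) := by
    simpa using ((tendsto_const_nhds (x := (1 : ℝ))).sub (hΦ.2 h)).const_mul 2
  refine squeeze_zero_norm (fun N => ?_) hlim
  set s := Φ N
  have hs : (0 : ℝ) < s.card := by exact_mod_cast (hΦ.1 N).card_pos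
  set t := s.image (h + ·)
  have ht : t.card = s.card := Finset.card_image_of_injective _ (add_right_injective h)
  have hnc : (((h + ·) '' (s : Set F)) ∩ (s : Set F)).ncard = (t ∩ s).card := by
    rw [← Set.ncard_coe_finset]
    simp [t]
  have hsum : ∑ u ∈ s, f (u + h) = ∑ u ∈ t, f u := by
    rw [Finset.sum_image fun x _ y _ hxy => add_right_injective h hxy]
    simp only [add_comm]
  have e1 : ((t \ s).card : ℝ) = s.card - (t ∩ s).card := by
    have := Finset.card_sdiff_add_card_inter t s
    rw [ht] at this
    rw [eq_sub_iff_add_eq]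
    exact_mod_cast this
  have e2 : ((s \ t).card : ℝ) = s.card - (t ∩ s).card := by
    have := Finset.card_sdiff_add_card_inter s t
    rw [Finset.inter_comm] at this
    rw [eq_sub_iff_add_eq]
    exact_mod_cast this
  have hle : ∀ a : Finset F, ‖∑ u ∈ a, f u‖ ≤ a.card := fun a =>
    (norm_sum_le _ _).trans ((Finset.sum_le_sum fun u _ => hf u).trans (by simp))
  rw [hnc, avg, avg, hsum, ← sub_div, ← Finset.sum_sdiff_sub_sum_sdiff, norm_div,
    Complex.norm_natCast, div_le_iff₀ hs]
  have : ‖∑ u ∈ t \ s, f u - ∑ u ∈ s \ t, f u‖ ≤ (t \ s).card + (s \ t).card :=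
    (norm_sub_le _ _).trans (add_le_add (hle _) (hle _))
  refine this.trans (le_of_eq ?_)
  rw [e1, e2]
  field_simp
  ring

/-- The van der Corput trick: if arbitrarily many translates of a bounded function are
asymptotically orthogonal along a Følner sequence, then its averages tend to `0`. -/
theorem tendsto_avg_of_orthogonal_translates {Φ : ℕ → Finset F} (hΦ : IsFolnerSeq Φ) {f : F → ℂ}
    (hf : ∀ u, ‖f u‖ ≤ 1)
    (horth : ∀ R : ℕ, ∃ h : Fin R → F, ∀ i j, i ≠ j →
      Tendsto (fun N => avg (Φ N) fun u => f (u + h i) * starRingEnd ℂ (f (u + h j)))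
        atTop (𝓝 0)) :
    Tendsto (fun N => avg (Φ N) f) atTop (𝓝 0) := by
  rw [tendsto_zero_iff_norm_tendsto_zero, Metric.tendsto_atTop']
  intro ε hε
  -- With `m ^ 2` translates, the averages are eventually at most `(m + 2) / m ^ 2 ≤ 3 / m`.
  obtain ⟨m, hm⟩ := exists_nat_gt (max 1 (3 / ε))
  have hm1 : (1 : ℝ) < m := (le_max_left _ _).trans_lt hm
  have hm3 : 3 / ε < m := (le_max_right _ _).trans_lt hm
  obtain ⟨h, hh⟩ := horth (m ^ 2)
  set g : F → ℂ := fun u => ∑ i, f (u + h i) with hg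
  -- The average of `g` is asymptotically `m ^ 2` times that of `f`.
  have hA : Tendsto (fun N => avg (Φ N) g - (m : ℂ) ^ 2 * avg (Φ N) f) atTop (𝓝 0) := by
    have : (fun N => avg (Φ N) g - (m : ℂ) ^ 2 * avg (Φ N) f) =
        fun N => ∑ i, (avg (Φ N) (fun u => f (u + h i)) - avg (Φ N) f) := by
      funext N
      rw [hg, avg_sum, Finset.sum_sub_distrib]
      simp
    rw [this]
    simpa using tendsto_finsetSum Finset.univ fun i _ => tendsto_avg_shift_sub hΦ hf (h i)
  -- The off-diagonal part of the average of `‖g‖ ^ 2` vanishes.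
  have hO : Tendsto (fun N => ∑ i, ∑ j ∈ Finset.univ.erase i,
      avg (Φ N) fun u => f (u + h i) * starRingEnd ℂ (f (u + h j))) atTop (𝓝 0) := by
    have := tendsto_finsetSum Finset.univ fun i _ =>
      tendsto_finsetSum (Finset.univ.erase i) fun j hj => hh i j (Finset.ne_of_mem_erase hj).symm
    simpa using this
  have hB : ∀ᶠ N in atTop, (∑ u ∈ Φ N, ‖g u‖ ^ 2) / (Φ N).card ≤ (m : ℝ) ^ 2 + 1 := by
    filter_upwards [(tendsto_zero_iff_norm_tendsto_zero.1 hO).eventually (ge_mem_nhds one_pos)]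
      with N hN
    have key : (((∑ u ∈ Φ N, ‖g u‖ ^ 2) / (Φ N).card : ℝ) : ℂ) =
        ∑ i, avg (Φ N) (fun u => f (u + h i) * starRingEnd ℂ (f (u + h i))) +
        ∑ i, ∑ j ∈ Finset.univ.erase i,
          avg (Φ N) fun u => f (u + h i) * starRingEnd ℂ (f (u + h j)) := by
      have e : (((∑ u ∈ Φ N, ‖g u‖ ^ 2) / (Φ N).card : ℝ) : ℂ) =
          avg (Φ N) fun u => g u * starRingEnd ℂ (g u) := by
        simp [avg, Complex.mul_conj, Complex.normSq_eq_norm_sq]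
      rw [e, ← Finset.sum_add_distrib]
      simp only [hg, map_sum, Finset.sum_mul_sum, avg_sum]
      refine Finset.sum_congr rfl fun i _ => ?_
      exact (Finset.add_sum_erase _
        (fun j => avg (Φ N) fun u => f (u + h i) * starRingEnd ℂ (f (u + h j)))
        (Finset.mem_univ i)).symm
    have hn : ‖(((∑ u ∈ Φ N, ‖g u‖ ^ 2) / (Φ N).card : ℝ) : ℂ)‖ ≤ (m : ℝ) ^ 2 + 1 := by
      rw [key]
      refine (norm_add_le _ _).trans (add_le_add ?_ hN)
      refine (norm_sum_le _ _).trans ((Finset.sum_le_sum fun i _ => norm_avg_le (Φ N) ?_).trans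
        (by simp))
      intro u
      rw [norm_mul, RCLike.norm_conj]
      exact mul_le_one₀ (hf _) (norm_nonneg _) (hf _)
    rw [Complex.norm_real] at hn
    exact (le_abs_self _).trans hn
  have hA' := (tendsto_zero_iff_norm_tendsto_zero.1 hA).eventually (ge_mem_nhds one_pos)
  obtain ⟨N₀, hN₀⟩ := eventually_atTop.1 (hA'.and hB)
  refine ⟨N₀, fun N hN => ?_⟩
  obtain ⟨h1, h2⟩ := hN₀ N hN.le
  have h3 : ‖avg (Φ N) g‖ ≤ m + 1 := by
    refine abs_le_of_sq_le_sq' ?_ (by positivity) |>.2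
    nlinarith [norm_sq_avg_le (Φ N) g]
  have h4 : (m : ℝ) ^ 2 * ‖avg (Φ N) f‖ ≤ m + 2 := by
    have e : (m : ℝ) ^ 2 * ‖avg (Φ N) f‖ = ‖(m : ℂ) ^ 2 * avg (Φ N) f‖ := by simp
    rw [e]
    have := norm_sub_norm_le ((m : ℂ) ^ 2 * avg (Φ N) f) (avg (Φ N) g)
    rw [norm_sub_rev] at this
    linarith
  rw [Real.dist_eq, sub_zero, abs_of_nonneg (norm_nonneg _)]
  rw [div_lt_iff₀ hε] at hm3
  by_contra hcon
  push Not at hcon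
  have : (m : ℝ) ^ 2 * ε ≤ m + 2 := (by gcongr : (m : ℝ) ^ 2 * ε ≤ (m : ℝ) ^ 2 * ‖avg (Φ N) f‖).trans h4
  nlinarith

end Mean

/-! ### Separating monomials by additive combinations of dilations -/

section Separation

open Polynomial in
/-- In characteristic `p`, if `p ∤ m` and `n` is not `m` times a power of `p`, then
`(X ^ n + 1) ^ m` and `(X ^ m + 1) ^ n` are different polynomials. -/
theorem X_pow_add_one_pow_ne {F : Type*} [Field F] (p : ℕ) [Fact p.Prime] [CharP F p] {m n : ℕ}
    (hm : ¬ p ∣ m) (hn : 0 < n) (hmn : ∀ e, n ≠ m * p ^ e) :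
    ((X : F[X]) ^ n + 1) ^ m ≠ (X ^ m + 1) ^ n := by
  have hp : p.Prime := Fact.out
  intro heq
  obtain ⟨e, a, ha, rfl⟩ := Nat.exists_eq_pow_mul_and_not_dvd hn.ne' p hp.ne_one
  have hm0 : 0 < m := Nat.pos_of_ne_zero fun h => hm (h ▸ dvd_zero p)
  have ha0 : 0 < a := Nat.pos_of_ne_zero fun h => ha (h ▸ dvd_zero p)
  have hpe : 0 < p ^ e := pow_pos hp.pos e
  have hmF : (m : F) ≠ 0 := fun h => hm ((CharP.cast_eq_zero_iff F p m).1 h)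
  have haF : (a : F) ≠ 0 := fun h => ha ((CharP.cast_eq_zero_iff F p a).1 h)
  have e1 : ((X : F[X]) ^ (p ^ e * a) + 1) ^ m = expand F (p ^ e * a) ((X + 1) ^ m) := by
    simp
  have e2 : ((X : F[X]) ^ m + 1) ^ (p ^ e * a) = expand F (m * p ^ e) ((X + 1) ^ a) := by
    rw [pow_mul, add_pow_char_pow, one_pow, ← pow_mul]
    simp
  rw [e1, e2] at heq
  -- Compare the lowest non-constant terms of the two sides.
  have c1 := congrArg (fun P => P.coeff (p ^ e * a)) heq
  have c2 := congrArg (fun P => P.coeff (m * p ^ e)) heq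
  simp only [coeff_expand hn, coeff_expand (Nat.mul_pos hm0 hpe), coeff_X_add_one_pow] at c1 c2
  rw [if_pos dvd_rfl, Nat.div_self hn, Nat.choose_one_right] at c1
  rw [if_pos (dvd_refl (m * p ^ e)), Nat.div_self (Nat.mul_pos hm0 hpe),
    Nat.choose_one_right] at c2
  have d1 : m * p ^ e ∣ p ^ e * a := by
    by_contra h
    rw [if_neg h] at c1
    exact hmF c1
  have d2 : p ^ e * a ∣ m * p ^ e := by
    by_contra h
    rw [if_neg h] at c2
    exact haF c2.symm
  exact hmn e (Nat.dvd_antisymm d2 d1)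

/-- The vector `n ↦ z ^ n` of powers of `z`, multiplicative in `z`. -/
def powVec (F : Type*) [Field F] : F →* (ℕ → F) where
  toFun z n := z ^ n
  map_one' := by funext n; simp
  map_mul' a b := by funext n; simp [mul_pow]

theorem powVec_apply {F : Type*} [Field F] (z : F) (n : ℕ) : powVec F z n = z ^ n := rfl

/-- Some additive combination of power vectors vanishes at all exponents in a finite set `S` but
not at `m`, provided that no element of `S` is `m` times a power of the characteristic. The additive
span of the power vectors is a ring, so it suffices to treat one `n ∈ S`, and the element
`(z ^ n + 1) ^ · - (z ^ · + 1) ^ n` vanishes at `n`. -/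
theorem exists_additive_combination {F : Type*} [Field F] [Infinite F] (p : ℕ) [Fact p.Prime]
    [CharP F p] {m : ℕ} (hm : ¬ p ∣ m) (S : Finset ℕ)
    (hS : ∀ n ∈ S, 0 < n ∧ ∀ e, n ≠ m * p ^ e) :
    ∃ v ∈ AddSubgroup.closure (Set.range (powVec F)), (∀ n ∈ S, v n = 0) ∧ v m ≠ 0 := by
  have hR : ∀ v, v ∈ AddSubgroup.closure (Set.range (powVec F)) ↔
      v ∈ Subring.closure (Set.range (powVec F)) := by
    intro v
    rw [Subring.mem_closure_iff, ← MonoidHom.coe_mrange, Submonoid.closure_eq]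
  have key : ∀ n ∈ S, ∃ v ∈ Subring.closure (Set.range (powVec F)), v n = 0 ∧ v m ≠ 0 := by
    intro n hn
    have hne := X_pow_add_one_pow_ne (F := F) p hm (hS n hn).1 (hS n hn).2
    obtain ⟨z, hz⟩ : ∃ z : F, (z ^ n + 1) ^ m ≠ (z ^ m + 1) ^ n := by
      by_contra hcon
      push Not at hcon
      exact hne (Polynomial.funext fun z => by simpa using hcon z)
    refine ⟨powVec F (z ^ n + 1) - (powVec F z + 1) ^ n, ?_, ?_, ?_⟩
    · exact sub_mem (Subring.subset_closure (Set.mem_range_self _))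
        (pow_mem (add_mem (Subring.subset_closure (Set.mem_range_self _)) (one_mem _)) n)
    · simp [powVec_apply]
    · simpa [powVec_apply, sub_eq_zero] using hz
  choose! v hv hv0 hv1 using key
  refine ⟨∏ n ∈ S, v n, (hR _).2 (prod_mem hv), fun n hn => ?_, ?_⟩
  · rw [Finset.prod_apply]
    exact Finset.prod_eq_zero hn (hv0 n hn)
  · rw [Finset.prod_apply]
    exact Finset.prod_ne_zero_iff.2 hv1

/-- With `Q = p ^ d`, the exponent `Q * (k₀ - 1) + 1` is not related by a power of `p` to any other
exponent `Q * (k - j) + j` with `1 ≤ j < k ≤ d` and `p ∤ k`: compare base-`Q` digits. -/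
theorem exponent_separation {p d k k₀ j e : ℕ} (hp : p.Prime) (hk : ¬ p ∣ k) (hkd : k ≤ d)
    (hj : 1 ≤ j) (hjk : j < k) (hk₀ : 1 ≤ k₀)
    (h : p ^ d * (k - j) + j = (p ^ d * (k₀ - 1) + 1) * p ^ e) : k = k₀ ∧ j = 1 := by
  have hjQ : j < p ^ d := (hjk.trans_le hkd).trans (Nat.lt_pow_self hp.one_lt)
  have hmod : j % p ^ d = p ^ e % p ^ d := by
    have := congrArg (· % p ^ d) h
    simpa [add_mul, Nat.add_mod, Nat.mul_mod, mul_assoc] using this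
  rw [Nat.mod_eq_of_lt hjQ] at hmod
  rcases lt_or_ge e d with he | he
  · rw [Nat.mod_eq_of_lt (Nat.pow_lt_pow_right hp.one_lt he)] at hmod
    subst hmod
    have h1 : p ^ d * (k - p ^ e) = p ^ d * ((k₀ - 1) * p ^ e) := by
      have : (p ^ d * (k₀ - 1) + 1) * p ^ e = p ^ d * ((k₀ - 1) * p ^ e) + p ^ e := by ring
      omega
    have h2 := Nat.eq_of_mul_eq_mul_left (pow_pos hp.pos d) h1
    have h3 : k = k₀ * p ^ e := by
      obtain ⟨c, rfl⟩ := Nat.exists_eq_add_of_le' hk₀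
      rw [Nat.add_sub_cancel] at h2
      rw [add_mul, one_mul, ← h2]
      omega
    have he0 : e = 0 := by
      by_contra h0
      exact hk (h3 ▸ dvd_mul_of_dvd_right (dvd_pow_self p h0) k₀)
    subst he0
    simpa using h3
  · rw [Nat.mod_eq_zero_of_dvd (pow_dvd_pow p he)] at hmod
    omega

end Separation

/-! ### Equidistribution of polynomial phases -/

section Equidistribution

variable {F : Type*} [Field F]

/-- In characteristic `p` every polynomial phase is a product of phases `u ↦ χ (u ^ k)` with
`p ∤ k`: powers of `p` in the exponent are absorbed in the character by the Frobenius map. -/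
theorem exists_normal_form (p : ℕ) [Fact p.Prime] [CharP F p] {d : ℕ} {κ : F → Circle}
    (hκ : κ ∈ phase F d) : ∃ χ : ℕ → AddChar F Circle,
      ∀ u, κ u = ∏ k ∈ (Finset.range (d + 1)).filter (¬ p ∣ ·), χ k (u ^ k) := by
  have hp : p.Prime := Fact.out
  induction hκ using Subgroup.closure_induction with
  | mem κ h =>
    obtain ⟨ψ, k, h1, h2, rfl⟩ := h
    obtain ⟨e, a, ha, rfl⟩ := Nat.exists_eq_pow_mul_and_not_dvd (by omega : k ≠ 0) p hp.ne_one
    refine ⟨Pi.mulSingle a (ψ.compAddMonoidHom (iterateFrobenius F p e).toAddMonoidHom),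
      fun u => ?_⟩
    have had : a ≤ d := (Nat.le_mul_of_pos_left a (pow_pos hp.pos e)).trans h2
    rw [Finset.prod_eq_single a]
    · simp [iterateFrobenius_def, ← pow_mul, mul_comm]
    · intro b _ hb
      simp [Pi.mulSingle_eq_of_ne hb]
    · intro h
      exact absurd (Finset.mem_filter.2 ⟨Finset.mem_range.2 (by omega), ha⟩) h
  | one => exact ⟨1, fun u => by simp⟩
  | mul a b _ _ ha hb =>
    obtain ⟨χ, hχ⟩ := ha
    obtain ⟨χ', hχ'⟩ := hb
    exact ⟨χ * χ', fun u => by simp [hχ, hχ', Finset.prod_mul_distrib]⟩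
  | inv a _ ha =>
    obtain ⟨χ, hχ⟩ := ha
    exact ⟨χ⁻¹, fun u => by simp [hχ, AddChar.map_neg_eq_inv]⟩

/-- The subgroup of those `h` for which `κ (v + h) = κ v * κ h` for all `v`. -/
noncomputable def addPeriods (κ : F → Circle) (h0 : κ 0 = 1) : AddSubgroup F where
  carrier := {h | ∀ v, κ (v + h) = κ v * κ h}
  zero_mem' v := by simp [h0]
  add_mem' {a b} ha hb v := by
    rw [← add_assoc, hb, ha, hb, mul_assoc]
  neg_mem' {a} ha v := by
    have h1 := ha (v + -a)
    have h2 := ha (-a)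
    rw [neg_add_cancel_right] at h1
    rw [neg_add_cancel, h0] at h2
    rw [h1, mul_assoc, mul_comm (κ a), ← h2, mul_one]

theorem mem_addPeriods {κ : F → Circle} {h0 : κ 0 = 1} {h : F} :
    h ∈ addPeriods κ h0 ↔ ∀ v, κ (v + h) = κ v * κ h := Iff.rfl

theorem mem_addPeriods_iff_cross {κ : F → Circle} {h0 : κ 0 = 1} {h : F} :
    h ∈ addPeriods κ h0 ↔ cross h κ = 1 := by
  rw [mem_addPeriods, funext_iff]
  exact forall_congr' fun v => by rw [cross_apply, Pi.one_apply, div_eq_one]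

/-- If the group of additive periods of a polynomial phase has finite index, then the phase is a
character. In characteristic zero there are no proper subgroups of finite index. In characteristic
`p`, take `κ u = ∏ χ k (u ^ k)` over `k` prime to `p`, and substitute `(z ^ Q * h, z * y)` for
`(h, v)` in `κ (v + h) = κ v * κ h`. Additive combinations over various `z` isolate the
term `χ k (k * h ^ (k - 1) * y)`, so `χ k` is trivial for `k ≥ 2`. -/
theorem isChar_of_finiteIndex [Infinite F] {d : ℕ} {κ : F → Circle} (hκ : κ ∈ phase F d)
    (hfin : (addPeriods κ (phase_apply_zero hκ)).FiniteIndex) :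
    ∀ h v, κ (v + h) = κ v * κ h := by
  set H := addPeriods κ (phase_apply_zero hκ) with hH
  obtain ⟨p, hpF⟩ := CharP.exists F
  rcases CharP.char_is_prime_or_zero F p with hp | rfl
  swap
  · have : CharZero F := CharP.charP_to_charZero F
    intro h
    have hi : (H.index : F) ≠ 0 := Nat.cast_ne_zero.2 hfin.index_ne_zero
    have := H.nsmul_index_mem (h / H.index)
    rw [nsmul_eq_mul, mul_div_cancel₀ _ hi] at this
    exact mem_addPeriods.1 this
  have : Fact p.Prime := ⟨hp⟩
  obtain ⟨χ, hχ⟩ := exists_normal_form p hκ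
  set S := (Finset.range (d + 1)).filter (¬ p ∣ ·) with hS
  have hS' : ∀ {k}, k ∈ S → 1 ≤ k ∧ k ≤ d ∧ ¬ p ∣ k := by
    intro k hk
    rw [hS, Finset.mem_filter, Finset.mem_range] at hk
    refine ⟨Nat.pos_of_ne_zero fun h => hk.2 (h ▸ dvd_zero p), by omega, hk.2⟩
  have hcross : ∀ h v, cross h κ v = ∏ k ∈ S, ∏ j ∈ Finset.Ico 1 k,
      χ k (((k.choose j : F) * h ^ (k - j)) * v ^ j) := by
    intro h v
    have : κ = ∏ k ∈ S, fun u => χ k (u ^ k) := by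
      funext u
      rw [hχ, Finset.prod_apply]
    rw [this, map_prod, Finset.prod_apply]
    exact Finset.prod_congr rfl fun k hk => cross_char_pow _ (hS' hk).1 h v
  set Q := p ^ d with hQ
  -- The relation obtained from an additive combination `w` of the substitutions.
  have hrel : ∀ w ∈ AddSubgroup.closure (Set.range (powVec F)),
      ∃ K : AddSubgroup F, K.FiniteIndex ∧ ∀ h ∈ K, ∀ y, ∏ k ∈ S, ∏ j ∈ Finset.Ico 1 k,
        χ k (((k.choose j : F) * h ^ (k - j)) * y ^ j * w (Q * (k - j) + j)) = 1 := by
    intro w hw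
    induction hw using AddSubgroup.closure_induction with
    | mem w hw =>
      obtain ⟨z, rfl⟩ := hw
      refine ⟨H.comap (AddMonoidHom.mulLeft (z ^ Q)), ⟨?_⟩, fun h hh y => ?_⟩
      · rw [AddSubgroup.index_comap]
        intro h0
        exact hfin.index_ne_zero (zero_dvd_iff.1 (h0 ▸ H.relIndex_dvd_index_of_normal _))
      · have h1 := mem_addPeriods_iff_cross.1 (AddSubgroup.mem_comap.1 hh)
        have h2 := congrFun h1 (z * y)
        rw [hcross, Pi.one_apply] at h2
        rw [← h2]
        refine Finset.prod_congr rfl fun k _ => Finset.prod_congr rfl fun j _ => ?_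
        congr 1
        rw [powVec_apply, AddMonoidHom.coe_mulLeft, mul_pow, mul_pow, pow_add, pow_mul]
        ring
    | zero => exact ⟨⊤, inferInstance, fun h _ y => by simp⟩
    | add a b _ _ ha hb =>
      obtain ⟨K, hK, ha⟩ := ha
      obtain ⟨L, hL, hb⟩ := hb
      refine ⟨K ⊓ L, inferInstance, fun h hh y => ?_⟩
      simp only [Pi.add_apply, mul_add, AddChar.map_add_eq_mul, Finset.prod_mul_distrib]
      rw [ha h hh.1 y, hb h hh.2 y, one_mul]
    | neg a _ ha =>
      obtain ⟨K, hK, ha⟩ := ha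
      refine ⟨K, hK, fun h hh y => ?_⟩
      simp only [Pi.neg_apply, mul_neg, AddChar.map_neg_eq_inv, Finset.prod_inv_distrib]
      rw [ha h hh y, inv_one]
  -- Choose `w` so that in the relation only the factor with `k = k₀` and `j = 1` survives.
  have htriv : ∀ k₀ ∈ S, 2 ≤ k₀ → χ k₀ = 1 := by
    intro k₀ hk₀ h2
    obtain ⟨-, hk₀d, hpk₀⟩ := hS' hk₀
    set m := Q * (k₀ - 1) + 1 with hm
    have hpm : ¬ p ∣ m := by
      intro h
      have h1 : p ∣ Q * (k₀ - 1) :=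
        dvd_mul_of_dvd_left (dvd_pow_self p (by omega : d ≠ 0)) _
      exact hp.one_lt.ne' (Nat.dvd_one.1 ((Nat.dvd_add_right h1).1 h))
    set T := ((S.sigma fun k => Finset.Ico 1 k).image
      fun x : (_ : ℕ) × ℕ => Q * (x.1 - x.2) + x.2).erase m with hT
    have hsep : ∀ k ∈ S, ∀ j ∈ Finset.Ico 1 k, ∀ e, Q * (k - j) + j = m * p ^ e →
        k = k₀ ∧ j = 1 := by
      intro k hk j hj e he
      rw [Finset.mem_Ico] at hj
      exact exponent_separation hp (hS' hk).2.2 (hS' hk).2.1 hj.1 hj.2 (by omega) he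
    obtain ⟨w, hw, hw0, hwm⟩ := exists_additive_combination (F := F) p hpm T (by
      intro n hn
      rw [hT, Finset.mem_erase, Finset.mem_image] at hn
      obtain ⟨hnm, ⟨k, j⟩, hkj, rfl⟩ := hn
      rw [Finset.mem_sigma] at hkj
      have hj := Finset.mem_Ico.1 hkj.2
      refine ⟨by dsimp only at hj ⊢; omega, fun e he => hnm ?_⟩
      obtain ⟨h1, h2⟩ := hsep k hkj.1 j hkj.2 e he
      dsimp only
      rw [h1, h2])
    obtain ⟨K, hK, hKr⟩ := hrel w hw
    obtain ⟨h, hhK, hh0⟩ : ∃ h ∈ K, h ≠ 0 := by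
      by_contra hcon
      push Not at hcon
      have hb : K = ⊥ := (AddSubgroup.eq_bot_iff_forall K).2 hcon
      exact hK.index_ne_zero (by rw [hb, AddSubgroup.index_bot, Nat.card_eq_zero_of_infinite])
    have hone : ∀ y, χ k₀ ((k₀ : F) * h ^ (k₀ - 1) * y * w m) = 1 := by
      intro y
      have h1 := hKr h hhK y
      rw [Finset.prod_eq_single k₀, Finset.prod_eq_single 1] at h1
      · simpa using h1
      · intro j hj hj1
        rw [hw0 _ (Finset.mem_erase.2 ⟨fun he => hj1 ?_, Finset.mem_image.2
          ⟨⟨k₀, j⟩, Finset.mem_sigma.2 ⟨hk₀, hj⟩, rfl⟩⟩), mul_zero, AddChar.map_zero_eq_one]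
        exact (hsep k₀ hk₀ j hj 0 (by simpa using he)).2
      · intro h
        exact absurd (Finset.mem_Ico.2 ⟨le_rfl, h2⟩) h
      · intro k hk hkk
        refine Finset.prod_eq_one fun j hj => ?_
        rw [hw0 _ (Finset.mem_erase.2 ⟨fun he => hkk ?_, Finset.mem_image.2
          ⟨⟨k, j⟩, Finset.mem_sigma.2 ⟨hk, hj⟩, rfl⟩⟩), mul_zero, AddChar.map_zero_eq_one]
        exact (hsep k hk j hj 0 (by simpa using he)).1
      · intro h
        exact absurd hk₀ h
    ext x
    have hk₀F : (k₀ : F) ≠ 0 := fun h => hpk₀ ((CharP.cast_eq_zero_iff F p k₀).1 h)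
    have := hone (x / ((k₀ : F) * h ^ (k₀ - 1) * w m))
    rw [show (k₀ : F) * h ^ (k₀ - 1) * (x / ((k₀ : F) * h ^ (k₀ - 1) * w m)) * w m = x by
      field_simp] at this
    rw [this, AddChar.one_apply]
  intro h v
  rw [hχ, hχ, hχ, ← Finset.prod_mul_distrib]
  refine Finset.prod_congr rfl fun k hk => ?_
  rcases (hS' hk).1.eq_or_lt with rfl | h2
  · simp [AddChar.map_add_eq_mul]
  · simp [htriv k hk h2]

/-- Non-trivial multiplicative functions `F → 𝕋` have mean zero. -/
theorem hasMeanZero_of_isChar {κ : F → Circle} (hκ : ∀ h v, κ (v + h) = κ v * κ h) (h1 : κ ≠ 1) :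
    HasMeanZero fun u => (κ u : ℂ) := by
  intro Φ hΦ
  obtain ⟨h, hh⟩ : ∃ h, κ h ≠ 1 := by
    by_contra hcon
    push Not at hcon
    exact h1 (funext hcon)
  have hne : (κ h : ℂ) - 1 ≠ 0 := by
    rw [sub_ne_zero, ← Circle.coe_one]
    exact fun h => hh (Circle.coe_injective h)
  have := tendsto_avg_shift_sub hΦ (f := fun u => (κ u : ℂ)) (fun u => (Circle.norm_coe _).le) h
  have e : (fun N => avg (Φ N) (fun u => (κ (u + h) : ℂ)) - avg (Φ N) fun u => (κ u : ℂ)) =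
      fun N => ((κ h : ℂ) - 1) * avg (Φ N) fun u => (κ u : ℂ) := by
    funext N
    simp only [hκ, Circle.coe_mul, mul_comm (κ _ : ℂ) (κ h : ℂ)]
    rw [avg_const_mul, sub_mul, one_mul]
  rw [e] at this
  simpa [hne] using this.const_mul ((κ h : ℂ) - 1)⁻¹

/-- A polynomial phase on an infinite field is either trivial or has mean zero. -/
theorem phase_eq_one_or_hasMeanZero [Infinite F] (d : ℕ) :
    ∀ κ ∈ phase F d, κ = 1 ∨ HasMeanZero fun u => (κ u : ℂ) := by
  induction d with
  | zero =>
    intro κ hκ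
    rw [phase_zero, Subgroup.mem_bot] at hκ
    exact Or.inl hκ
  | succ d ih =>
    intro κ hκ
    rw [or_iff_not_imp_left]
    intro hne
    set H := addPeriods κ (phase_apply_zero hκ) with hH
    by_cases hfin : H.FiniteIndex
    · exact hasMeanZero_of_isChar (isChar_of_finiteIndex hκ hfin) hne
    · intro Φ hΦ
      have : Infinite (F ⧸ H) := by
        by_contra hcon
        rw [not_infinite_iff_finite] at hcon
        exact hfin AddSubgroup.finiteIndex_of_finite_quotient
      refine tendsto_avg_of_orthogonal_translates hΦ (fun u => (Circle.norm_coe _).le) fun R => ?_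
      -- Translates by representatives of distinct cosets of `H` are orthogonal.
      refine ⟨fun i => (Infinite.natEmbedding (F ⧸ H) i).out, fun i j hij => ?_⟩
      set a : F := (Infinite.natEmbedding (F ⧸ H) i).out with ha
      set b : F := (Infinite.natEmbedding (F ⧸ H) j).out with hb
      have hab : a - b ∉ H := by
        intro h
        have h1 : (b : F ⧸ H) = a := QuotientAddGroup.eq.2 (by rwa [neg_add_eq_sub])
        rw [ha, hb, QuotientAddGroup.out_eq', QuotientAddGroup.out_eq'] at h1
        exact hij (Fin.ext ((Infinite.natEmbedding _).injective h1).symm)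
      have hc1 : cross (a - b) κ ≠ 1 := fun h => hab (mem_addPeriods_iff_cross.2 h)
      have hc := (ih _ (cross_mem_phase hκ (a - b))).resolve_left hc1 Φ hΦ
      have hshift := (tendsto_avg_shift_sub hΦ
        (f := fun u => (cross (a - b) κ u : ℂ)) (fun u => (Circle.norm_coe _).le) b).add hc
      simp only [sub_add_cancel, add_zero] at hshift
      have := hshift.const_mul (κ (a - b) : ℂ)
      rw [mul_zero] at this
      refine this.congr fun N => ?_
      rw [← avg_const_mul]
      congr 1
      funext u
      have e : u + a = (u + b) + (a - b) := by abel
      rw [e, apply_add_eq (a - b) κ (u + b), ← Circle.coe_inv_eq_conj, ← Circle.coe_mul,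
        ← Circle.coe_mul]
      congr 1
      rw [mul_assoc (κ (u + b)), mul_comm (κ (u + b)), mul_assoc _ (κ (u + b)), mul_inv_cancel,
        mul_one]

end Equidistribution

/-! ### The spectral measure of a vector -/

section Spectral

open WeakDual CompactlySupported
open scoped ComplexOrder

/-- A positive functional on a commutative C⋆-algebra is integration against a finite measure on
the character space, by Gelfand duality and the Riesz–Markov–Kakutani theorem. -/
theorem exists_measure_characterSpace {A : Type*} [CommCStarAlgebra A] (τ : A →ₗ[ℂ] ℂ)
    (hτ : ∀ a, 0 ≤ τ (star a * a)) :
    ∃ (_ : MeasurableSpace (characterSpace ℂ A)) (_ : BorelSpace (characterSpace ℂ A))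
      (ν : Measure (characterSpace ℂ A)), IsFiniteMeasure ν ∧ ∀ a, τ a = ∫ ω, ω a ∂ν := by
  let : MeasurableSpace (characterSpace ℂ A) := borel _
  have : BorelSpace (characterSpace ℂ A) := ⟨rfl⟩
  set Γ := gelfandStarTransform A
  let J : C(characterSpace ℂ A, ℝ) →ₗ[ℝ] C(characterSpace ℂ A, ℂ) :=
    { toFun h := ⟨fun ω => (h ω : ℂ), by fun_prop⟩
      map_add' x y := by ext; simp
      map_smul' c x := by ext; simp }
  have hJ : ∀ h ω, J h ω = (h ω : ℂ) := fun _ _ => rfl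
  let L : C(characterSpace ℂ A, ℝ) →ₗ[ℝ] ℂ :=
    { toFun h := τ (Γ.symm (J h))
      map_add' x y := by simp
      map_smul' c x := by
        have : J (c • x) = (c : ℂ) • J x := by ext; simp [hJ]
        rw [this]
        simp }
  have hL : ∀ h, L h = τ (Γ.symm (J h)) := fun _ => rfl
  have hpos : ∀ h, 0 ≤ h → 0 ≤ L h := by
    intro h hh
    let s : C(characterSpace ℂ A, ℝ) := ⟨fun ω => Real.sqrt (h ω), by fun_prop⟩
    have hs : J h = star (J s) * J s := by
      ext ω
      have : Real.sqrt (h ω) * Real.sqrt (h ω) = h ω := Real.mul_self_sqrt (hh ω)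
      simp only [ContinuousMap.mul_apply, ContinuousMap.star_apply, hJ, s, ContinuousMap.coe_mk,
        RCLike.star_def, Complex.conj_ofReal]
      exact_mod_cast this.symm
    rw [hL, hs, map_mul, map_star]
    exact hτ _
  -- Real functions have real values under `L`: add `‖h‖` to make `h` non-negative.
  have him : ∀ h, (L h).im = 0 := by
    intro h
    have h1 : 0 ≤ L (h + ContinuousMap.const _ ‖h‖) := by
      refine hpos _ fun ω => ?_
      have := (abs_le.1 (h.norm_coe_le_norm ω)).1
      change 0 ≤ h ω + ‖h‖
      linarith
    have h2 : 0 ≤ L (ContinuousMap.const _ ‖h‖) := hpos _ fun ω => norm_nonneg h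
    rw [Complex.le_def] at h1 h2
    have h3 := h1.2
    rw [map_add, Complex.add_im, ← h2.2] at h3
    simpa using h3.symm
  let Λ : C_c(characterSpace ℂ A, ℝ) →ₚ[ℝ] ℝ := PositiveLinearMap.mk₀
    { toFun h := (L h.toContinuousMap).re
      map_add' x y := by
        have : (x + y).toContinuousMap = x.toContinuousMap + y.toContinuousMap := rfl
        rw [this, map_add, Complex.add_re]
      map_smul' c x := by
        have : (c • x).toContinuousMap = c • x.toContinuousMap := rfl
        rw [this, map_smul]
        simp }
    (fun x hx => (Complex.le_def.1 (hpos x.toContinuousMap hx)).1)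
  have hint : ∀ h : C(characterSpace ℂ A, ℝ),
      L h = ((∫ ω, h ω ∂(RealRMK.rieszMeasure Λ) : ℝ) : ℂ) := by
    intro h
    have := RealRMK.integral_rieszMeasure Λ ⟨h, HasCompactSupport.of_compactSpace h⟩
    apply Complex.ext
    · rw [Complex.ofReal_re]
      exact this.symm
    · rw [him, Complex.ofReal_im]
  refine ⟨inferInstance, inferInstance, RealRMK.rieszMeasure Λ, inferInstance, fun a => ?_⟩
  set ν := RealRMK.rieszMeasure Λ
  let x : C(characterSpace ℂ A, ℝ) := ⟨fun ω => (ω a).re,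
    Complex.continuous_re.comp (Γ a).continuous⟩
  let y : C(characterSpace ℂ A, ℝ) := ⟨fun ω => (ω a).im,
    Complex.continuous_im.comp (Γ a).continuous⟩
  have hxy : Γ a = J x + Complex.I • J y := by
    ext ω
    have := Complex.re_add_im (ω a)
    rw [mul_comm] at this
    exact this.symm
  have ha : a = Γ.symm (J x) + Complex.I • Γ.symm (J y) := by
    rw [← map_smul, ← map_add, ← hxy, StarAlgEquiv.symm_apply_apply]
  have e : τ a = L x + Complex.I * L y := by
    conv_lhs => rw [ha]
    rw [map_add, map_smul, smul_eq_mul, hL, hL]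
  have hi : Integrable (fun ω : characterSpace ℂ A => ω a) ν :=
    (Γ a).continuous.integrable_of_hasCompactSupport (HasCompactSupport.of_compactSpace _)
  rw [e, hint, hint, mul_comm]
  exact integral_re_add_im hi

universe u

variable {G : Type*} {H : Type u} [AddCommGroup G] [NormedAddCommGroup H] [InnerProductSpace ℂ H]
  [CompleteSpace H]

/-- Bochner's theorem for the matrix coefficient of a unitary representation `U` of an abelian group
without topology: `⟪f, U g f⟫` is an average of characters of the group. -/
theorem exists_spectral_measure (U : G → H →L[ℂ] H) (h0 : U 0 = 1)
    (hadd : ∀ a b, U (a + b) = U a * U b) (hstar : ∀ a, star (U a) = U (-a)) (f : H) :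
    ∃ (Ω : Type u) (_ : MeasurableSpace Ω) (ν : Measure Ω) (_ : IsFiniteMeasure ν)
      (e : Ω → AddChar G Circle), (∀ g, Measurable fun ω => (e ω g : ℂ)) ∧
        ∀ g, inner ℂ f (U g f) = ∫ ω, (e ω g : ℂ) ∂ν := by
  let A := (StarAlgebra.adjoin ℂ (Set.range U)).topologicalClosure
  have hc : ∀ x y : StarAlgebra.adjoin ℂ (Set.range U), x * y = y * x := by
    have := StarAlgebra.isMulCommutative_adjoin ℂ (s := Set.range U)
      (by rintro _ ⟨a, rfl⟩ _ ⟨b, rfl⟩; rw [← hadd, ← hadd, add_comm])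
      (by rintro _ ⟨a, rfl⟩ _ ⟨b, rfl⟩; rw [hstar, ← hadd, ← hadd, add_comm])
    exact fun x y => mul_comm' x y
  have : IsClosed (A : Set (H →L[ℂ] H)) := StarSubalgebra.isClosed_topologicalClosure _
  let : CommCStarAlgebra A :=
    { StarSubalgebra.cstarAlgebra A with
      mul_comm := (StarSubalgebra.commRingTopologicalClosure _ hc).mul_comm }
  let V : G → A := fun g => ⟨U g, StarSubalgebra.le_topologicalClosure _
    (StarAlgebra.subset_adjoin ℂ _ ⟨g, rfl⟩)⟩
  have hV0 : V 0 = 1 := Subtype.ext h0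
  have hVadd : ∀ a b, V (a + b) = V a * V b := fun a b => Subtype.ext (hadd a b)
  have hVstar : ∀ a, star (V a) = V (-a) := fun a => Subtype.ext (hstar a)
  let τ : A →ₗ[ℂ] ℂ :=
    { toFun a := inner ℂ f ((a : H →L[ℂ] H) f)
      map_add' a b := by simp
      map_smul' c a := by simp }
  obtain ⟨_, _, ν, hν, hint⟩ := exists_measure_characterSpace τ (by
    intro a
    have : τ (star a * a) = inner ℂ ((a : H →L[ℂ] H) f) ((a : H →L[ℂ] H) f) := by
      change inner ℂ f ((star (a : H →L[ℂ] H) * (a : H →L[ℂ] H)) f) = _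
      rw [mul_apply_eq_comp, ContinuousLinearMap.star_eq_adjoint,
        ContinuousLinearMap.adjoint_inner_right]
    rw [this, inner_self_eq_norm_sq_to_K]
    norm_cast
    exact Complex.zero_le_real.2 (sq_nonneg _))
  have hnorm : ∀ (ω : characterSpace ℂ A) g, ω (V g) ∈ Submonoid.unitSphere ℂ := by
    intro ω g
    rw [Submonoid.unitSphere, ← SetLike.mem_coe, Submonoid.coe_set_mk, Subsemigroup.coe_set_mk,
      mem_sphere_zero_iff_norm]
    have h1 : star (ω (V g)) * ω (V g) = 1 := by
      rw [← map_star, ← map_mul, hVstar, ← hVadd, neg_add_cancel, hV0, map_one]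
    have h2 : ‖ω (V g)‖ * ‖ω (V g)‖ = 1 := by
      rw [← CStarRing.norm_star_mul_self, h1, norm_one]
    nlinarith [norm_nonneg (ω (V g))]
  refine ⟨characterSpace ℂ A, inferInstance, ν, hν, fun ω =>
    { toFun g := ⟨ω (V g), hnorm ω g⟩
      map_zero_eq_one' := Subtype.ext (by simp [hV0])
      map_add_eq_mul' a b := 
        Subtype.ext ((congrArg ω (hVadd a b)).trans (map_mul ω _ _)) }, fun g => ?_, fun g => hint (V g)⟩
  exact (gelfandStarTransform A (V g)).continuous.measurable

end Spectral

/-! ### The diffuse part of the spectral measure -/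

section Diffuse

/-- If `‖b‖ ^ 2` has mean zero, then `‖b‖` is small off a set of zero upper Banach density. -/
theorem upperBanachDensity_eq_zero {F : Type*} [AddCommGroup F] {b : F → ℂ}
    (hb : HasMeanZero fun u => ((‖b u‖ ^ 2 : ℝ) : ℂ)) {δ : ℝ} (hδ : 0 < δ) :
    upperBanachDensity {u | δ ≤ ‖b u‖} = 0 := by
  classical
  simp only [upperBanachDensity, ENNReal.iSup_eq_zero]
  intro Φ hΦ
  refine Tendsto.limsup_eq ?_
  have hlim : Tendsto (fun N => ENNReal.ofReal
      (‖avg (Φ N) fun u => ((‖b u‖ ^ 2 : ℝ) : ℂ)‖ / δ ^ 2)) atTop (𝓝 0) := by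
    have := ENNReal.tendsto_ofReal ((tendsto_zero_iff_norm_tendsto_zero.1 (hb Φ hΦ)).div_const (δ ^ 2))
    simpa using this
  refine tendsto_of_tendsto_of_tendsto_of_le_of_le tendsto_const_nhds hlim
    (fun N => zero_le) fun N => ?_
  have hc : (0 : ℝ) < (Φ N).card := by exact_mod_cast (hΦ.1 N).card_pos
  have hset : {u | δ ≤ ‖b u‖} ∩ (Φ N : Set F) = ((Φ N).filter fun u => δ ≤ ‖b u‖ : Finset F) := by
    ext u
    simp [and_comm]
  dsimp only
  rw [hset, Set.ncard_coe_finset, ← ENNReal.ofReal_natCast, ← ENNReal.ofReal_natCast,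
    ← ENNReal.ofReal_div_of_pos hc]
  refine ENNReal.ofReal_le_ofReal ?_
  have hn : ‖avg (Φ N) fun u => ((‖b u‖ ^ 2 : ℝ) : ℂ)‖ = (∑ u ∈ Φ N, ‖b u‖ ^ 2) / (Φ N).card := by
    rw [avg, ← Complex.ofReal_sum, norm_div, Complex.norm_natCast, Complex.norm_real,
      Real.norm_of_nonneg (Finset.sum_nonneg fun _ _ => sq_nonneg _)]
  rw [hn, div_right_comm]
  gcongr
  rw [le_div_iff₀ (by positivity), ← nsmul_eq_mul]
  calc _ ≤ ∑ u ∈ (Φ N).filter fun u => δ ≤ ‖b u‖, ‖b u‖ ^ 2 := by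
        refine Finset.card_nsmul_le_sum _ _ _ fun u hu => ?_
        have := (Finset.mem_filter.1 hu).2
        gcongr
    _ ≤ _ := Finset.sum_le_sum_of_subset_of_nonneg (Finset.filter_subset _ _)
        fun _ _ _ => sq_nonneg _

/-- Wiener's lemma for a family of unimodular functions, distinct ones of which have quotients of mean
zero: the mean of the squared modulus of the integral is the measure of the diagonal, which vanishes
for a diffuse measure. -/
theorem hasMeanZero_norm_sq_integral {F Ω : Type*} [AddCommGroup F] [Countable F]
    [MeasurableSpace Ω] (ν : Measure Ω) [IsFiniteMeasure ν] (κ : Ω → F → Circle)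
    (hm : ∀ u, Measurable fun ω => (κ ω u : ℂ))
    (hκ : ∀ ω ω', κ ω = κ ω' ∨ HasMeanZero fun u => ((κ ω u * (κ ω' u)⁻¹ : Circle) : ℂ))
    (hν : ∀ ω, ν {ω' | κ ω = κ ω'} = 0) :
    HasMeanZero fun u => ((‖∫ ω, (κ ω u : ℂ) ∂ν‖ ^ 2 : ℝ) : ℂ) := by
  intro Φ hΦ
  have hm2 : ∀ u, Measurable fun x : Ω × Ω => ((κ x.1 u * (κ x.2 u)⁻¹ : Circle) : ℂ) := by
    intro u
    simp only [Circle.coe_mul, Circle.coe_inv]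
    exact ((hm u).comp measurable_fst).mul ((hm u).comp measurable_snd).inv
  have hdiag : ∀ᵐ x ∂(ν.prod ν), κ x.1 ≠ κ x.2 := by
    have hms : MeasurableSet {x : Ω × Ω | κ x.1 = κ x.2} := by
      have : {x : Ω × Ω | κ x.1 = κ x.2} = ⋂ u, {x | (κ x.1 u : ℂ) = κ x.2 u} := by
        ext x
        simp only [Set.mem_iInter, Set.mem_ofPred_eq, funext_iff, Circle.coe_inj]
      rw [this]
      exact MeasurableSet.iInter fun u => measurableSet_eq_fun
        ((hm u).comp measurable_fst) ((hm u).comp measurable_snd)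
    have : (ν.prod ν) {x : Ω × Ω | κ x.1 = κ x.2} = 0 := by
      rw [Measure.measure_prod_null hms]
      exact Eventually.of_forall hν
    rw [ae_iff]
    simpa using this
  have hint : ∀ u, Integrable (fun x : Ω × Ω => ((κ x.1 u * (κ x.2 u)⁻¹ : Circle) : ℂ))
      (ν.prod ν) := fun u =>
    Integrable.of_bound (hm2 u).aestronglyMeasurable 1
      (Eventually.of_forall fun x => (Circle.norm_coe _).le)
  have hav : ∀ N, avg (Φ N) (fun u => ((‖∫ ω, (κ ω u : ℂ) ∂ν‖ ^ 2 : ℝ) : ℂ)) =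
      ∫ x, avg (Φ N) (fun u => ((κ x.1 u * (κ x.2 u)⁻¹ : Circle) : ℂ)) ∂(ν.prod ν) := by
    intro N
    simp only [avg]
    rw [integral_div, integral_finsetSum _ fun u _ => hint u]
    congr 1
    refine Finset.sum_congr rfl fun u _ => ?_
    simp only [Circle.coe_mul, Circle.coe_inv_eq_conj]
    rw [integral_prod_mul (fun ω => (κ ω u : ℂ)) fun ω => starRingEnd ℂ (κ ω u : ℂ), integral_conj,
      Complex.mul_conj, Complex.normSq_eq_norm_sq]
  simp only [hav]
  rw [← integral_zero (Ω × Ω) ℂ (μ := ν.prod ν)]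
  refine tendsto_integral_of_dominated_convergence (fun _ => 1) (fun N => ?_)
    (integrable_const _) (fun N => Eventually.of_forall fun x =>
      norm_avg_le _ fun u => (Circle.norm_coe _).le) ?_
  · exact ((Finset.measurable_fun_sum _ fun u _ => hm2 u).div_const _).aestronglyMeasurable
  · filter_upwards [hdiag] with x hx
    exact (hκ x.1 x.2).resolve_left hx Φ hΦ

end Diffuse

/-! ### Atoms of the spectral measure -/

section Atoms

/-- The atoms of a finite measure are countable in number, and finitely many of them carry all but
an arbitrarily small part of the mass of the atomic part. -/
theorem exists_finset_atoms {Z : Type*} [MeasurableSpace Z] [MeasurableSingletonClass Z]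
    (ν : Measure Z) [IsFiniteMeasure ν] {δ : ℝ≥0∞} (hδ : 0 < δ) :
    {z | ν {z} ≠ 0}.Countable ∧ ∃ t : Finset Z, (∀ z ∈ t, ν {z} ≠ 0) ∧
      ν ({z | ν {z} ≠ 0} \ t) < δ := by
  classical
  have hD : {z | ν {z} ≠ 0}.Countable := by
    have := Measure.countable_meas_pos_of_disjoint_iUnion (μ := ν) (As := fun z : Z => {z})
      (fun z => measurableSet_singleton z) fun a b hab => Set.disjoint_singleton.2 hab
    simpa only [pos_iff_ne_zero] using this
  refine ⟨hD, ?_⟩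
  set D := {z | ν {z} ≠ 0} with hDdef
  have : Countable D := hD.to_subtype
  have hsum : ∑' z : D, ν {(z : Z)} ≠ ∞ := by
    rw [← measure_iUnion (fun a b hab => Set.disjoint_singleton.2 fun h => hab (Subtype.ext h))
      fun z => measurableSet_singleton _]
    exact measure_ne_top _ _
  obtain ⟨s, hs⟩ := ((ENNReal.tendsto_tsum_compl_atTop_zero hsum).eventually
    (gt_mem_nhds hδ)).exists
  refine ⟨s.image Subtype.val, fun z hz => ?_, lt_of_le_of_lt ?_ hs⟩
  · obtain ⟨w, -, rfl⟩ := Finset.mem_image.1 hz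
    exact w.2
  · refine (measure_mono fun z hz => ?_).trans (measure_iUnion_le fun b : {x : D // x ∉ s} =>
      ({((b : D) : Z)} : Set Z))
    refine Set.mem_iUnion.2 ⟨⟨⟨z, hz.1⟩, fun h => hz.2 ?_⟩, rfl⟩
    exact Finset.mem_coe.2 (Finset.mem_image.2 ⟨_, h, rfl⟩)

variable {F : Type*} [Field F] [Infinite F]

/-- The set where finitely many polynomial phases have positive real part is `MC*`. -/
theorem isMCStar_re_pos {d : ℕ} (t : Finset (F → ℂ))
    (ht : ∀ z ∈ t, ∃ κ ∈ phase F d, z = fun u => (κ u : ℂ)) :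
    IsMCStar {u : F | ∀ z ∈ t, 0 < (z u).re} := by
  rintro C ⟨p, -, ⟨S, hS, hpS⟩, hC⟩
  have h : ∀ z ∈ t, ∀ᶠ u : Fˣ in (p : Filter Fˣ), 0 < (z u).re := by
    intro z hz
    obtain ⟨κ, hκ, rfl⟩ := ht z hz
    have h1 := tendsto_ulim p fun u : Fˣ => κ u
    rw [ulim_phase_of_minimal hS hpS hκ] at h1
    have h2 : Continuous fun z : Circle => (z : ℂ).re :=
      Complex.continuous_re.comp continuous_subtype_val
    exact (h2.tendsto 1).comp h1 |>.eventually (lt_mem_nhds (by simp))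
  obtain ⟨u, hu1, hu2⟩ := (((Finset.eventually_all t).2 h).and hC).exists
  exact ⟨u, hu1, hu2⟩

/-- A mixture of characters of `(F, +)`, evaluated along a polynomial without constant term, has
almost non-negative real part on an almost `MC*` set. Off a set of zero density the diffuse part of
the mixture is negligible, and on an `MC*` set the large atoms contribute non-negatively. -/
theorem exists_isMCStar_integral_re_gt [Countable F] {Ω : Type*} [MeasurableSpace Ω]
    (ν : Measure Ω) [IsFiniteMeasure ν] (e : Ω → AddChar F Circle)
    (he : ∀ g, Measurable fun ω => (e ω g : ℂ)) (φ : Polynomial F) (hφ : φ.coeff 0 = 0)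
    {ε : ℝ} (hε : 0 < ε) :
    ∃ A E : Set F, IsMCStar A ∧ upperBanachDensity E = 0 ∧
      ∀ u ∈ A \ E, -ε < (∫ ω, (e ω (φ.eval u) : ℂ) ∂ν).re := by
  set κ : Ω → F → Circle := fun ω u => e ω (φ.eval u) with hκdef
  have hκ : ∀ ω, κ ω ∈ phase F φ.natDegree := fun ω => char_eval_mem_phase (e ω) φ hφ
  set K : Ω → F → ℂ := fun ω u => (κ ω u : ℂ) with hKdef
  have hK : Measurable K := measurable_pi_lambda _ fun u => he _
  obtain ⟨hD, t, htD, htδ⟩ := exists_finset_atoms (ν.map K) (δ := ENNReal.ofReal (ε / 2))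
    (by simpa using hε)
  set D := {z | ν.map K {z} ≠ 0} with hDdef
  have hDm : MeasurableSet (K ⁻¹' D) := hK hD.measurableSet
  have htm : MeasurableSet (K ⁻¹' t) := hK t.measurableSet
  have htsub : K ⁻¹' (t : Set (F → ℂ)) ⊆ K ⁻¹' D := fun ω hω => htD _ hω
  set b : F → ℂ := fun u => ∫ ω in (K ⁻¹' D)ᶜ, (κ ω u : ℂ) ∂ν with hb
  have hmz : HasMeanZero fun u => ((‖b u‖ ^ 2 : ℝ) : ℂ) := by
    refine hasMeanZero_norm_sq_integral _ κ (fun u => he _) (fun ω ω' => ?_) fun ω => ?_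
    · rcases phase_eq_one_or_hasMeanZero _ _ (div_mem (hκ ω) (hκ ω')) with h | h
      · exact Or.inl (div_eq_one.1 h)
      · refine Or.inr ?_
        simpa only [Pi.div_apply, div_eq_mul_inv] using h
    · have hKeq : {ω' | κ ω = κ ω'} = K ⁻¹' {K ω} := by
        ext ω'
        simp only [Set.mem_preimage, Set.mem_singleton_iff, Set.mem_ofPred_eq, hKdef, funext_iff,
          Circle.coe_inj, eq_comm]
      rw [hKeq, Measure.restrict_apply (hK (measurableSet_singleton _))]
      by_cases h : K ω ∈ D
      · convert measure_empty (μ := ν)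
        rw [Set.eq_empty_iff_forall_notMem]
        rintro ω' ⟨h1, h2⟩
        exact h2 (by rw [Set.mem_preimage, (h1 : K ω' = K ω)]; exact h)
      · refine measure_mono_null Set.inter_subset_left ?_
        rw [hDdef, Set.mem_ofPred_eq, not_not, Measure.map_apply hK (measurableSet_singleton _)] at h
        exact h
  refine ⟨{u | ∀ z ∈ t, 0 < (z u).re}, {u | ε / 2 ≤ ‖b u‖}, isMCStar_re_pos (d := φ.natDegree) t fun z hz => ?_,
    upperBanachDensity_eq_zero hmz (half_pos hε), ?_⟩
  · have h0 := htD z hz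
    rw [Measure.map_apply hK (measurableSet_singleton _)] at h0
    obtain ⟨ω, hω⟩ := nonempty_of_measure_ne_zero h0
    exact ⟨κ ω, hκ ω, hω.symm⟩
  rintro u ⟨hA, hE⟩
  have hE' : ‖b u‖ < ε / 2 := not_le.1 hE
  have hint : Integrable (fun ω => (κ ω u : ℂ)) ν :=
    Integrable.of_bound (he _).aestronglyMeasurable 1
      (Eventually.of_forall fun x => (Circle.norm_coe _).le)
  -- Split into the large atoms, the remaining atoms and the diffuse part.
  have hsplit : ∫ ω, (κ ω u : ℂ) ∂ν = ∫ ω in K ⁻¹' (t : Set (F → ℂ)), (κ ω u : ℂ) ∂ν +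
      ∫ ω in K ⁻¹' D \ K ⁻¹' (t : Set (F → ℂ)), (κ ω u : ℂ) ∂ν + b u := by
    rw [setIntegral_sdiff htm hint.integrableOn htsub, add_sub_cancel, hb,
      integral_add_compl hDm hint]
  have h1 : 0 ≤ (∫ ω in K ⁻¹' (t : Set (F → ℂ)), (κ ω u : ℂ) ∂ν).re := by
    have := integral_re (hint.restrict (s := K ⁻¹' (t : Set (F → ℂ))))
    simp only [RCLike.re_to_complex] at this
    rw [← this]
    exact setIntegral_nonneg htm fun ω hω => (hA (K ω) hω).le
  have h2 : ‖∫ ω in K ⁻¹' D \ K ⁻¹' (t : Set (F → ℂ)), (κ ω u : ℂ) ∂ν‖ ≤ ε / 2 := by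
    have hlt : ν (K ⁻¹' D \ K ⁻¹' (t : Set (F → ℂ))) < ENNReal.ofReal (ε / 2) := by
      rw [← Set.preimage_sdiff, ← Measure.map_apply hK (hD.measurableSet.diff t.measurableSet)]
      exact htδ
    have := norm_setIntegral_le_of_norm_le_const (f := fun ω => (κ ω u : ℂ)) (C := 1)
      (measure_lt_top ν (K ⁻¹' D \ K ⁻¹' (t : Set (F → ℂ)))) fun ω _ => (Circle.norm_coe _).le
    rw [one_mul] at this
    exact this.trans (ENNReal.toReal_le_of_le_ofReal (half_pos hε).le hlt.le)
  have h3 := (abs_le.1 ((Complex.abs_re_le_norm _).trans h2)).1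
  have h4 := (abs_lt.1 ((Complex.abs_re_le_norm (b u)).trans_lt hE')).1
  change -ε < (∫ ω, (κ ω u : ℂ) ∂ν).re
  rw [hsplit, Complex.add_re, Complex.add_re]
  linarith

end Atoms

/-! ### The Koopman representation -/

section Koopman

variable {F X : Type*} [AddCommGroup F] [MeasurableSpace X] (μ : Measure X)
  [AddAction F X] [MeasurableConstVAdd F X] [VAddInvariantMeasure F X μ]

/-- The Koopman operators `f ↦ f (-g +ᵥ ·)` of a measure-preserving action on `L²(μ)`. -/
noncomputable def koopman (g : F) : Lp ℂ 2 μ →L[ℂ] Lp ℂ 2 μ :=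
  (Lp.compMeasurePreservingₗᵢ ℂ (fun x : X => -g +ᵥ x)
    (measurePreserving_vadd (-g) μ)).toContinuousLinearMap

theorem koopman_apply (g : F) (f : Lp ℂ 2 μ) :
    koopman μ g f = Lp.compMeasurePreserving (fun x : X => -g +ᵥ x)
      (measurePreserving_vadd (-g) μ) f := rfl

theorem koopman_zero : koopman μ (0 : F) = 1 := by
  ext1 f
  apply Lp.ext
  rw [koopman_apply]
  filter_upwards [Lp.coeFn_compMeasurePreserving f (measurePreserving_vadd (-(0 : F)) μ)] with x hx
  rw [hx]
  simp

theorem koopman_add (a b : F) : koopman μ (a + b) = koopman μ a * koopman μ b := by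
  ext1 f
  apply Lp.ext
  rw [mul_apply_eq_comp, koopman_apply, koopman_apply, koopman_apply]
  have h1 := Lp.coeFn_compMeasurePreserving f (measurePreserving_vadd (-(a + b)) μ)
  have h2 := Lp.coeFn_compMeasurePreserving (Lp.compMeasurePreserving (fun x : X => -b +ᵥ x)
    (measurePreserving_vadd (-b) μ) f) (measurePreserving_vadd (-a) μ)
  have h3 := (measurePreserving_vadd (-a) μ).quasiMeasurePreserving.ae
    (Lp.coeFn_compMeasurePreserving f (measurePreserving_vadd (-b) μ))
  filter_upwards [h1, h2, h3] with x hx1 hx2 hx3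
  rw [hx1, hx2, Function.comp_apply, Function.comp_apply, hx3, Function.comp_apply, vadd_vadd,
    neg_add_rev]

theorem star_koopman (a : F) : star (koopman μ a) = koopman μ (-a) := by
  rw [ContinuousLinearMap.star_eq_adjoint, eq_comm, ContinuousLinearMap.eq_adjoint_iff]
  intro x y
  have h1 : koopman μ a (koopman μ (-a) x) = x := by
    rw [← mul_apply_eq_comp, ← koopman_add, add_neg_cancel, koopman_zero]
    rfl
  have h2 : inner ℂ (koopman μ a (koopman μ (-a) x)) (koopman μ a y) =
      inner ℂ (koopman μ (-a) x) y := LinearIsometry.inner_map_map _ _ _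
  rw [← h2, h1]

/-- The matrix coefficient of the Koopman representation at the centred indicator of `B`. -/
theorem exists_inner_koopman_eq [IsProbabilityMeasure μ] {B : Set X} (hB : MeasurableSet B) :
    ∃ f : Lp ℂ 2 μ, ∀ g : F,
      inner ℂ f (koopman μ g f) = ((μ.real (B ∩ (g +ᵥ B)) - μ.real B ^ 2 : ℝ) : ℂ) := by
  set c := μ.real B with hc
  set r : X → ℝ := fun x => B.indicator 1 x - c with hr
  have hrm : Measurable r := (measurable_one.indicator hB).sub_const c
  have hmem : MemLp (fun x => (r x : ℂ)) 2 μ := by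
    refine MemLp.of_bound (Complex.measurable_ofReal.comp hrm).aestronglyMeasurable (1 + |c|)
      (Eventually.of_forall fun x => ?_)
    rw [Complex.norm_real, hr]
    refine (norm_sub_le _ _).trans (add_le_add ?_ le_rfl)
    by_cases h : x ∈ B <;> simp [h]
  refine ⟨hmem.toLp _, fun g => ?_⟩
  have hgB : MeasurableSet (g +ᵥ B) := hB.const_vadd g
  have hgc : μ.real (g +ᵥ B) = c := by rw [hc, measureReal_def, measureReal_def, measure_vadd]
  have e1 : inner ℂ (hmem.toLp _) (koopman μ g (hmem.toLp _)) =
      ∫ x, ((r x * r (-g +ᵥ x) : ℝ) : ℂ) ∂μ := by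
    rw [L2.inner_def]
    refine integral_congr_ae ?_
    have h1 := hmem.coeFn_toLp
    have h2 := Lp.coeFn_compMeasurePreserving (hmem.toLp _) (measurePreserving_vadd (-g) μ)
    have h3 := (measurePreserving_vadd (-g) μ).quasiMeasurePreserving.ae hmem.coeFn_toLp
    rw [koopman_apply]
    filter_upwards [h1, h2, h3] with x hx1 hx2 hx3
    rw [hx1, hx2, Function.comp_apply, hx3, RCLike.inner_apply, Complex.conj_ofReal,
      Complex.ofReal_mul, mul_comm]
  have e2 : ∀ x, r x * r (-g +ᵥ x) = (B ∩ (g +ᵥ B)).indicator 1 x - c * B.indicator 1 x -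
      c * (g +ᵥ B).indicator 1 x + c ^ 2 := by
    intro x
    have hx : -g +ᵥ x ∈ B ↔ x ∈ g +ᵥ B := Set.mem_vadd_set_iff_neg_vadd_mem.symm
    simp only [hr]
    by_cases h1 : x ∈ B <;> by_cases h2 : x ∈ g +ᵥ B <;>
      simp [Set.indicator, h1, h2, hx] <;> ring
  have hi : ∀ {s : Set X}, MeasurableSet s → Integrable (s.indicator (1 : X → ℝ)) μ :=
    fun hs => (integrable_const (1 : ℝ)).indicator hs
  rw [e1, integral_complex_ofReal]
  congr 1
  simp only [e2]
  have i1 := hi (hB.inter hgB)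
  have i2 := (hi hB).const_mul c
  have i3 := (hi hgB).const_mul c
  have i12 : Integrable (fun x => (B ∩ (g +ᵥ B)).indicator 1 x - c * B.indicator 1 x) μ :=
    i1.sub i2
  have i123 : Integrable (fun x => (B ∩ (g +ᵥ B)).indicator 1 x - c * B.indicator 1 x -
    c * (g +ᵥ B).indicator 1 x) μ := i12.sub i3
  rw [integral_add i123 (integrable_const _), integral_sub i12 i3, integral_sub i1 i2,
    integral_const_mul, integral_const_mul, integral_indicator_one (hB.inter hgB),
    integral_indicator_one hB, integral_indicator_one hgB, hgc, ← hc]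
  simp
  ring

end Koopman

/-! ### Almost `MC*` sets -/

theorem upperBanachDensity_mono {G : Type*} [AddCommGroup G] {S T : Set G} (h : S ⊆ T) :
    upperBanachDensity S ≤ upperBanachDensity T := by
  refine iSup₂_mono fun Φ _ => limsup_le_limsup (Eventually.of_forall fun N => ?_)
  dsimp only
  gcongr
  exact (Φ N).finite_toSet.inter_of_right T

/-- A set that contains an almost `MC*` set is almost `MC*`. -/
theorem IsAMCStar.of_diff_subset {F : Type*} [Field F] {A E S : Set F} (hA : IsMCStar A)
    (hE : upperBanachDensity E = 0) (h : A \ E ⊆ S) : IsAMCStar S := by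
  refine ⟨A ∪ S, A \ S, fun C hC => (hA C hC).mono (by gcongr; exact Set.subset_union_left), ?_, ?_⟩
  · refine le_antisymm (hE ▸ upperBanachDensity_mono fun u hu => ?_) zero_le
    by_contra hcon
    exact hu.2 (h ⟨hu.1, hcon⟩)
  · ext u
    simp only [Set.mem_sdiff, Set.mem_union]
    tauto

end PolyRec

theorem mainTheorem2 {F : Type*} [Field F] [Countable F] [Infinite F]
    {X : Type*} [MeasurableSpace X] (μ : Measure X) [IsProbabilityMeasure μ]
    [AddAction F X] [MeasurableConstVAdd F X] [VAddInvariantMeasure F X μ]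
    (φ : Polynomial F) (hφ : φ.coeff 0 = 0)
    (B : Set X) (hB : MeasurableSet B) (ε : ℝ) (hε : 0 < ε) :
    PolyRec.IsAMCStar
      {u : F | μ.real (B ∩ (φ.eval u +ᵥ B)) > μ.real B ^ 2 - ε} := by
  obtain ⟨f, hf⟩ := PolyRec.exists_inner_koopman_eq (F := F) μ hB
  obtain ⟨Ω, _, ν, _, e, he, hint⟩ := PolyRec.exists_spectral_measure (PolyRec.koopman (F := F) μ)
    (PolyRec.koopman_zero μ) (PolyRec.koopman_add μ) (PolyRec.star_koopman μ) f
  obtain ⟨A, E, hA, hE, hAE⟩ := PolyRec.exists_isMCStar_integral_re_gt ν e he φ hφ hε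
  refine PolyRec.IsAMCStar.of_diff_subset hA hE fun u hu => ?_
  have := hAE u hu
  rw [← hint, hf, Complex.ofReal_re] at this
  rw [Set.mem_ofPred_eq]
  linarith
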